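/- For each $n$ let $p_n=a_n/n$ and $q_n=b_n/n$ be in $[0,1]$. Let $(\sigma,G)$ be drawn from the planted partition model $\mathcal G(n,p_n,q_n)$: each of the $n$ vertices receives, independently and uniformly at random, a label $\sigma_u\in\{\pm1\}$, and, given the labels, each pair of distinct vertices $u,v$ is joined by an edge of the graph $G$ independently, with probability $p_n$ if $\sigma_u=\sigma_v$ and $q_n$ if $\sigma_u\neq\sigma_v$. For labelings $\sigma,\tau\in\{\pm1\}^n$ let \[ \mathrm{ov}(\sigma,\tau)=\frac1n\Bigl(\sum_{i=1}^n\sigma_i\tau_i-\frac1n\Bigl(\sum_{i=1}^n\sigma_i\Bigr)\Bigl(\sum_{i=1}^n\tau_i\Bigr)\Bigr). \] A labeling estimate is a (possibly randomized) map that assigns to every graph $G$ on $n$ vertices a labeling $\hat\sigma=\hat\sigma(G)\in\{\pm1\}^n$; it sees only $G$ and its own independent randomness, and may depend on $n,a_n,b_n$. (i) Suppose $a_n\to\infty$, $b_n\to\infty$, $a_n=o(n)$, and $(a_n-b_n)^2<2(a_n+b_n)$ for all sufficiently large $n$. Then for every sequence of labeling estimates, $\mathrm{ov}(\sigma,\hat\sigma)\to0$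 in probability as $n\to\infty$. (ii) Suppose $a_n/n\to p\in(0,1)$ and $c_n:=(a_n-b_n)^2/(a_n+b_n)$ satisfies $\frac{c_n}{2(1-p)}<1$ for all sufficiently large $n$. Then for every sequence of labeling estimates, $\mathrm{ov}(\sigma,\hat\sigma)\to0$ in probability as $n\to\infty$. Thus in both regimes no reconstruction algorithm does asymptotically better than random guessing. -/

import Mathlib

open Filter Topology Asymptotics

/-- A `±1`-labeling of the vertices `0, …, n - 1`. -/
abbrev Labeling (n : ℕ) : Type := Fin n → ℤˣ

namespace SBM

noncomputable section

/-- The unordered pairs of distinct vertices, each one listed once. -/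
def pairs (n : ℕ) : Finset (Fin n × Fin n) :=
  Finset.univ.filter fun e => e.1 < e.2

/-- The probability of an edge between `u` and `v` given the labels: `p` if the labels agree,
`q` if they differ. -/
def edgeProb {n : ℕ} (p q : unitInterval) (σ : Labeling n) (u v : Fin n) : ℝ :=
  if σ u = σ v then (p : ℝ) else (q : ℝ)

open Classical in
/-- The conditional probability of the graph `G` given the labeling `σ`: edges are present
independently, with the probabilities `edgeProb`. -/
def graphProb {n : ℕ} (p q : unitInterval) (σ : Labeling n) (G : SimpleGraph (Fin n)) : ℝ :=
  ∏ e ∈ pairs n, if G.Adj e.1 e.2 then edgeProb p q σ e.1 e.2 else 1 - edgeProb p q σ e.1 e.2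

/-- The joint probability of the labeling `σ` (uniform on all `2 ^ n` labelings) and the
graph `G`. -/
def mass {n : ℕ} (p q : unitInterval) (x : Labeling n × SimpleGraph (Fin n)) : ℝ :=
  (1 / 2 : ℝ) ^ n * graphProb p q x.1 x.2

theorem edgeProb_mem {n : ℕ} (p q : unitInterval) (σ : Labeling n) (u v : Fin n) :
    0 ≤ edgeProb p q σ u v ∧ edgeProb p q σ u v ≤ 1 := by
  unfold edgeProb
  split_ifs
  · exact p.2
  · exact q.2

theorem graphProb_nonneg {n : ℕ} (p q : unitInterval) (σ : Labeling n)
    (G : SimpleGraph (Fin n)) : 0 ≤ graphProb p q σ G := by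
  classical
  unfold graphProb
  refine Finset.prod_nonneg fun e _ => ?_
  have h := edgeProb_mem p q σ e.1 e.2
  split_ifs
  · exact h.1
  · linarith [h.2]

theorem mass_nonneg {n : ℕ} (p q : unitInterval) (x : Labeling n × SimpleGraph (Fin n)) :
    0 ≤ mass p q x :=
  mul_nonneg (by positivity) (graphProb_nonneg p q x.1 x.2)

theorem sum_graphProb {n : ℕ} (p q : unitInterval) (σ : Labeling n) :
    ∑ G : SimpleGraph (Fin n), graphProb p q σ G = 1 := by
  classical
  have h := Finset.prod_add (fun e : Fin n × Fin n => edgeProb p q σ e.1 e.2)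
    (fun e => 1 - edgeProb p q σ e.1 e.2) (pairs n)
  have h1 : ∏ e ∈ pairs n, (edgeProb p q σ e.1 e.2 + (1 - edgeProb p q σ e.1 e.2)) = 1 :=
    Finset.prod_eq_one fun e _ => by ring
  rw [h1] at h
  rw [h]
  refine Finset.sum_bij' (fun G _ => (pairs n).filter fun e => G.Adj e.1 e.2)
    (fun t _ => SimpleGraph.fromRel fun u v => (u, v) ∈ t)
    (fun G _ => by simp) (fun _ _ => Finset.mem_univ _) ?_ ?_ ?_
  · intro G _
    ext u v
    simp only [SimpleGraph.fromRel_adj, Finset.mem_filter, pairs, Finset.mem_univ, true_and]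
    constructor
    · rintro ⟨_, h | h⟩
      · exact h.2
      · exact h.2.symm
    · intro h
      refine ⟨h.ne, ?_⟩
      rcases lt_or_gt_of_ne h.ne with h' | h'
      · exact Or.inl ⟨h', h⟩
      · exact Or.inr ⟨h', h.symm⟩
  · intro t ht
    have ht' := Finset.mem_powerset.1 ht
    ext ⟨u, v⟩
    simp only [SimpleGraph.fromRel_adj, Finset.mem_filter]
    constructor
    · rintro ⟨h, _, h' | h'⟩
      · exact h'
      · have h2 := ht' h'
        simp only [pairs, Finset.mem_filter, Finset.mem_univ, true_and] at h h2
        exact absurd h (lt_asymm h2)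
    · intro h
      have h2 := ht' h
      refine ⟨h2, ?_, Or.inl h⟩
      simp only [pairs, Finset.mem_filter, Finset.mem_univ, true_and] at h2
      exact h2.ne
  · intro G _
    unfold graphProb
    rw [Finset.prod_ite, Finset.filter_not]

theorem sum_mass {n : ℕ} (p q : unitInterval) :
    ∑ x : Labeling n × SimpleGraph (Fin n), mass p q x = 1 := by
  rw [Fintype.sum_prod_type]
  simp only [mass, ← Finset.mul_sum, sum_graphProb]
  simp

/-- The planted partition model `𝒢(n, p, q)`: the joint law of the true labeling and of the
random graph. -/
def model (n : ℕ) (p q : unitInterval) : PMF (Labeling n × SimpleGraph (Fin n)) :=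
  PMF.ofFintype (fun x => ENNReal.ofReal (mass p q x)) (by
    rw [← ENNReal.ofReal_sum_of_nonneg fun x _ => mass_nonneg p q x, sum_mass,
      ENNReal.ofReal_one])

/-- The overlap of two labelings. -/
def overlap {n : ℕ} (σ τ : Labeling n) : ℝ :=
  1 / (n : ℝ) * (∑ i, ((σ i : ℤ) : ℝ) * ((τ i : ℤ) : ℝ)
    - 1 / (n : ℝ) * (∑ i, ((σ i : ℤ) : ℝ)) * (∑ i, ((τ i : ℤ) : ℝ)))

/-- A labeling estimate, for graphs with `n` vertices: it sees only the graph, and may use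
additional randomness, so it assigns to each graph the law of a labeling. A deterministic
estimate `f` is `fun G => PMF.pure (f G)`. -/
abbrev Estimate (n : ℕ) : Type := SimpleGraph (Fin n) → PMF (Labeling n)

/-- The law of the overlap of the true labeling with its estimate, when the labeled graph is
drawn from `𝒢(n, p, q)` and the estimate is computed from the graph. -/
def overlapLaw {n : ℕ} (p q : unitInterval) (est : Estimate n) : PMF ℝ :=
  (model n p q).bind fun x => (est x.2).map fun τ => overlap x.1 τ

/-- A sequence of laws on `ℝ` converges to `0` in probability. -/
def TendstoZeroInProbability (μ : ℕ → PMF ℝ) : Prop :=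
  ∀ ε : ℝ, 0 < ε → Tendsto (fun n => (μ n).toMeasure {x : ℝ | ε ≤ |x|}) atTop (𝓝 0)

end

end SBM

/-!
Two posterior samples `σ` and `τ` of the labels control every estimate `σ̂`: given the graph, the
mean square of `overlap σ σ̂` is a quadratic form in the posterior second moments of `σ`, which
Cauchy–Schwarz bounds by the root mean square of `replicaOverlap σ τ`. For two posterior samples,
Jensen's inequality replaces the law of the graph by the Erdős–Rényi law of the same mean density,
at the cost of a relative entropy with a favourable sign. Under this law the graph integrates out,
and what is left is the partition function of the Curie–Weiss model on `σ * τ`, whose inverse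
temperature is `n * snr p q`. Up to the critical value `1` this partition function grows
subexponentially, and slightly beyond it the exponential rate is of second order, so the replica
overlap tends to `0`.
-/

namespace SBM

open scoped BigOperators

section CurieWeiss

/-- The labels as real numbers, so that labelings can be paired and summed in `ℝ`. -/
def spin {n : ℕ} (x : Labeling n) : Fin n → ℝ := fun i => ((x i : ℤ) : ℝ)

theorem spin_sq {n : ℕ} (x : Labeling n) (i : Fin n) : spin x i ^ 2 = 1 := by
  rcases Int.units_eq_one_or (x i) with h | h <;> simp [spin, h]

theorem spin_dotProduct {n : ℕ} (σ τ : Labeling n) :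
    spin σ ⬝ᵥ spin τ = ∑ i, spin (σ * τ) i := by
  simp [spin, dotProduct]

theorem expect_labeling_eq {n : ℕ} (f : Labeling n → ℝ) :
    𝔼 x, f x = (1 / 2 : ℝ) ^ n * ∑ x, f x := by
  simp [Fintype.expect_eq_sum_div_card, div_eq_inv_mul]

theorem expect_exp_mul_sum_spin (n : ℕ) (r : ℝ) :
    𝔼 x : Labeling n, Real.exp (r * ∑ i, spin x i) = Real.cosh r ^ n := by
  have hsite : Real.cosh r = 1 / 2 * ∑ u : ℤˣ, Real.exp (r * (u : ℤ)) := by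
    rw [Real.cosh_eq, show (Finset.univ : Finset ℤˣ) = {1, -1} from rfl,
      Finset.sum_pair (by decide)]
    simp only [Units.val_one, Int.cast_one, mul_one, Units.val_neg, Int.cast_neg, mul_neg]
    ring
  rw [expect_labeling_eq, hsite, mul_pow, Fintype.sum_pow]
  simp only [Finset.mul_sum, Real.exp_sum, spin]

/-- The quartic term, missing from `Real.cosh_le_exp_half_sq`, is what controls the Curie–Weiss
model at the critical temperature. -/
theorem cosh_le_exp_sq_sub_pow_four {r : ℝ} (hr : |r| ≤ 1) :
    Real.cosh r ≤ Real.exp (r ^ 2 / 2 - r ^ 4 / 24) := by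
  have hr2 : r ^ 2 ≤ 1 := (sq_le_one_iff_abs_le_one r).2 hr
  have htaylor : Real.cosh r ≤ 1 + r ^ 2 / 2 + 5 / 96 * r ^ 4 := by
    have hpos := (abs_le.1 (Real.exp_bound hr (n := 4) (by norm_num))).2
    have hneg := (abs_le.1 (Real.exp_bound (x := -r) (by rwa [abs_neg]) (n := 4)
      (by norm_num))).2
    simp only [Finset.sum_range_succ, Finset.sum_range_zero, Nat.factorial, abs_neg,
      Even.pow_abs (by decide : Even 4)] at hpos hneg
    norm_num at hpos hneg
    rw [Real.cosh_eq]
    linarith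
  have hexp := Real.quadratic_le_exp_of_nonneg
    (show 0 ≤ r ^ 2 / 2 - r ^ 4 / 24 by nlinarith [sq_nonneg r])
  nlinarith [pow_nonneg (sq_nonneg r) 2, pow_nonneg (sq_nonneg r) 4]

theorem exp_mul_cosh_le {r : ℝ} (hr : |r| ≤ 1) (η : ℝ) :
    Real.exp (-(1 - η) * r ^ 2 / 2) * Real.cosh r ≤ Real.exp (3 / 2 * η ^ 2) := by
  calc Real.exp (-(1 - η) * r ^ 2 / 2) * Real.cosh r
      ≤ Real.exp (-(1 - η) * r ^ 2 / 2) * Real.exp (r ^ 2 / 2 - r ^ 4 / 24) := by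
        gcongr
        exact cosh_le_exp_sq_sub_pow_four hr
    _ = Real.exp (3 / 2 * η ^ 2 - (r ^ 2 - 6 * η) ^ 2 / 24) := by
        rw [← Real.exp_add]
        ring_nf
    _ ≤ Real.exp (3 / 2 * η ^ 2) := by
        gcongr
        linarith [sq_nonneg (r ^ 2 - 6 * η)]

theorem exists_sum_spin_eq {n : ℕ} (x : Labeling n) :
    ∃ k ∈ Finset.Icc (-n : ℤ) n, ∑ i, spin x i = k := by
  refine ⟨∑ i, (x i : ℤ), ?_, by simp [spin]⟩
  rw [Finset.mem_Icc, ← abs_le]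
  calc |∑ i, (x i : ℤ)| ≤ ∑ i, |(x i : ℤ)| := Finset.abs_sum_le_sum_abs _ _
    _ = n := by simp [Int.abs_eq_natAbs]

/-- The left-hand side is the partition function of the Curie–Weiss model. Each possible value `k`
of the total spin is tilted separately, with its own saddle point `k / n`. -/
theorem expect_exp_sq_sum_spin_le {n : ℕ} (hn : 0 < n) (η : ℝ) :
    𝔼 x : Labeling n, Real.exp ((1 + η) / (2 * n) * (∑ i, spin x i) ^ 2)
      ≤ (2 * n + 1) * Real.exp (n * (3 / 2 * η ^ 2)) := by
  have hn' : (0 : ℝ) < n := by exact_mod_cast hn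
  set I := Finset.Icc (-n : ℤ) n with hI
  let tilt (k : ℤ) : ℝ := Real.exp (-(1 - η) * (k / n) ^ 2 / 2) ^ n
  have htilt (x : Labeling n) : Real.exp ((1 + η) / (2 * n) * (∑ i, spin x i) ^ 2)
      ≤ ∑ k ∈ I, tilt k * Real.exp (k / n * ∑ i, spin x i) := by
    obtain ⟨k, hk, hxk⟩ := exists_sum_spin_eq x
    calc Real.exp ((1 + η) / (2 * n) * (∑ i, spin x i) ^ 2)
        = tilt k * Real.exp (k / n * ∑ i, spin x i) := by
          simp only [hxk, tilt, ← Real.exp_nat_mul, ← Real.exp_add]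
          congr 1
          field_simp
          ring
      _ ≤ ∑ k ∈ I, tilt k * Real.exp (k / n * ∑ i, spin x i) :=
          Finset.single_le_sum (f := fun k : ℤ => tilt k * Real.exp (k / n * ∑ i, spin x i))
            (fun k _ => by positivity) hk
  calc 𝔼 x : Labeling n, Real.exp ((1 + η) / (2 * n) * (∑ i, spin x i) ^ 2)
      ≤ 𝔼 x : Labeling n, ∑ k ∈ I, tilt k * Real.exp (k / n * ∑ i, spin x i) :=
        Finset.expect_le_expect fun x _ => htilt x
    _ = ∑ k ∈ I, (Real.exp (-(1 - η) * (k / n) ^ 2 / 2) * Real.cosh (k / n)) ^ n := by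
        simp_rw [Finset.expect_sum_comm, ← Finset.mul_expect, expect_exp_mul_sum_spin, tilt,
          mul_pow]
    _ ≤ ∑ k ∈ I, Real.exp (3 / 2 * η ^ 2) ^ n := by
        gcongr with k hk
        refine exp_mul_cosh_le ?_ η
        rw [abs_div, Nat.abs_cast, div_le_one hn']
        exact_mod_cast abs_le.2 (Finset.mem_Icc.1 hk)
    _ = (2 * n + 1) * Real.exp (n * (3 / 2 * η ^ 2)) := by
        have hcard : I.card = 2 * n + 1 := by rw [hI, Int.card_Icc]; omega
        rw [Finset.sum_const, hcard, nsmul_eq_mul, ← Real.exp_nat_mul]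
        push_cast
        rfl

theorem expect_expect_mul {n : ℕ} (f : Labeling n → ℝ) :
    𝔼 σ : Labeling n, 𝔼 τ, f (σ * τ) = 𝔼 x, f x := by
  have htranslate (σ : Labeling n) : 𝔼 τ, f (σ * τ) = 𝔼 x, f x :=
    Fintype.expect_equiv (Equiv.mulLeft σ) _ _ fun _ => rfl
  simp only [htranslate, Fintype.expect_const]

end CurieWeiss

section Replicas

theorem sum_mul_log_div_nonneg {γ : Type*} [Fintype γ] {M Q : γ → ℝ}
    (hM : ∀ G, 0 ≤ M G) (hQ : ∀ G, 0 ≤ Q G) (hac : ∀ G, Q G = 0 → M G = 0)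
    (hle : ∑ G, Q G ≤ ∑ G, M G) :
    0 ≤ ∑ G, M G * Real.log (M G / Q G) := by
  have hpoint (G : γ) : M G - Q G ≤ M G * Real.log (M G / Q G) := by
    rcases (hM G).eq_or_lt with hMG | hMG
    · simp [← hMG, hQ G]
    · have hQG : 0 < Q G := (hQ G).lt_of_ne' fun h => hMG.ne' (hac G h)
      calc M G - Q G = M G * (1 - (M G / Q G)⁻¹) := by field_simp
        _ ≤ M G * Real.log (M G / Q G) := by
          gcongr
          exact Real.one_sub_inv_le_log_of_pos (div_pos hMG hQG)
  calc 0 ≤ ∑ G, (M G - Q G) := by rw [Finset.sum_sub_distrib]; exact sub_nonneg.2 hle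
    _ ≤ ∑ G, M G * Real.log (M G / Q G) := Finset.sum_le_sum fun G _ => hpoint G

variable {α γ : Type*} [Fintype α]

/-- The second marginal of a weight on `α × γ`. For `w = mass p q` this is the law of the
graph. -/
def marginal (w : α × γ → ℝ) (G : γ) : ℝ := ∑ σ, w (σ, G)

/-- The law of `(G, σ, τ)`, where `σ` and `τ` are conditionally independent samples of the first
component given the second component `G`. It vanishes where `marginal w G = 0`, by `x / 0 = 0`. -/
noncomputable def replicaWeight (w : α × γ → ℝ) (z : γ × α × α) : ℝ :=
  w (z.2.1, z.1) * w (z.2.2, z.1) / marginal w z.1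

/-- The mean of `f σ τ` over two conditionally independent samples `σ` and `τ`. -/
noncomputable def replicaMean [Fintype γ] (w : α × γ → ℝ) (f : α → α → ℝ) : ℝ :=
  ∑ z : γ × α × α, replicaWeight w z * f z.2.1 z.2.2

variable {w : α × γ → ℝ}

theorem marginal_nonneg (hw : ∀ x, 0 ≤ w x) (G : γ) : 0 ≤ marginal w G :=
  Finset.sum_nonneg fun _ _ => hw _

theorem eq_zero_of_marginal_eq_zero (hw : ∀ x, 0 ≤ w x) {G : γ} (hG : marginal w G = 0)
    (σ : α) : w (σ, G) = 0 :=
  (Finset.sum_eq_zero_iff_of_nonneg fun _ _ => hw _).1 hG σ (Finset.mem_univ σ)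

theorem replicaWeight_nonneg (hw : ∀ x, 0 ≤ w x) (z : γ × α × α) : 0 ≤ replicaWeight w z :=
  div_nonneg (mul_nonneg (hw _) (hw _)) (marginal_nonneg hw _)

theorem replicaWeight_mul_marginal (hw : ∀ x, 0 ≤ w x) (z : γ × α × α) :
    replicaWeight w z * marginal w z.1 = w (z.2.1, z.1) * w (z.2.2, z.1) :=
  div_mul_cancel_of_imp fun hG => by simp [eq_zero_of_marginal_eq_zero hw hG]

theorem sum_mul_eq_marginal_sq (w : α × γ → ℝ) (G : γ) :
    ∑ z : α × α, w (z.1, G) * w (z.2, G) = marginal w G * marginal w G := by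
  rw [marginal, Finset.sum_mul_sum, Fintype.sum_prod_type]

variable [Fintype γ]

theorem sum_marginal (hw1 : ∑ x, w x = 1) : ∑ G, marginal w G = 1 := by
  rw [← hw1, Fintype.sum_prod_type_right]
  rfl

theorem sum_replicaWeight_mul (w : α × γ → ℝ) (g : γ → ℝ) :
    ∑ z, replicaWeight w z * g z.1 = ∑ G, marginal w G * g G := by
  simp only [Fintype.sum_prod_type (α₁ := γ), replicaWeight, ← Finset.sum_mul, ← Finset.sum_div,
    sum_mul_eq_marginal_sq, mul_self_div_self]

theorem replicaMean_const_mul (w : α × γ → ℝ) (c : ℝ) (f : α → α → ℝ) :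
    replicaMean w (fun σ τ => c * f σ τ) = c * replicaMean w f := by
  simp only [replicaMean, Finset.mul_sum, mul_left_comm]

/-- Replacing the law of the second component by a reference law `Q` is a change of measure with
density `marginal w / Q`. By Jensen's inequality its cost is the relative entropy of `marginal w`
with respect to `Q`, which is nonnegative and can be dropped. -/
theorem exp_replicaMean_le (hw : ∀ x, 0 ≤ w x) (hw1 : ∑ x, w x = 1) {Q : γ → ℝ}
    (hQ : ∀ G, 0 ≤ Q G) (hQ1 : ∑ G, Q G = 1) (hac : ∀ G, Q G = 0 → marginal w G = 0)
    (f : α → α → ℝ) :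
    Real.exp (replicaMean w f)
      ≤ ∑ z : γ × α × α, w (z.2.1, z.1) * w (z.2.2, z.1) / Q z.1 * Real.exp (f z.2.1 z.2.2) := by
  have hM := marginal_nonneg hw
  have hP1 : ∑ z, replicaWeight w z = 1 := by
    simpa [sum_marginal hw1] using sum_replicaWeight_mul w fun _ => 1
  have hentropy : 0 ≤ ∑ z, replicaWeight w z * Real.log (marginal w z.1 / Q z.1) := by
    rw [sum_replicaWeight_mul w fun G => Real.log (marginal w G / Q G)]
    exact sum_mul_log_div_nonneg hM hQ hac (by rw [hQ1, sum_marginal hw1])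
  have hdensity (z : γ × α × α) :
      replicaWeight w z * Real.exp (Real.log (marginal w z.1 / Q z.1) + f z.2.1 z.2.2)
        = w (z.2.1, z.1) * w (z.2.2, z.1) / Q z.1 * Real.exp (f z.2.1 z.2.2) := by
    rcases (hM z.1).eq_or_lt with hMz | hMz
    · simp [replicaWeight, eq_zero_of_marginal_eq_zero hw hMz.symm]
    · have hQz : 0 < Q z.1 := (hQ z.1).lt_of_ne' fun h => hMz.ne' (hac z.1 h)
      rw [Real.exp_add, Real.exp_log (div_pos hMz hQz), ← replicaWeight_mul_marginal hw]
      ring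
  calc Real.exp (replicaMean w f)
      ≤ Real.exp (∑ z, replicaWeight w z *
          (Real.log (marginal w z.1 / Q z.1) + f z.2.1 z.2.2)) := by
        simp only [mul_add, Finset.sum_add_distrib]
        exact Real.exp_le_exp.2 (le_add_of_nonneg_left hentropy)
    _ ≤ ∑ z, replicaWeight w z *
          Real.exp (Real.log (marginal w z.1 / Q z.1) + f z.2.1 z.2.2) :=
        convexOn_exp.map_sum_le (fun z _ => replicaWeight_nonneg hw z) hP1
          fun _ _ => Set.mem_univ _
    _ = ∑ z : γ × α × α, w (z.2.1, z.1) * w (z.2.2, z.1) / Q z.1 * Real.exp (f z.2.1 z.2.2) :=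
        Finset.sum_congr rfl fun z _ => hdensity z

theorem sum_sqrt_sum_le_sqrt_replicaMean (hw : ∀ x, 0 ≤ w x) (hw1 : ∑ x, w x = 1)
    {f : α → α → ℝ} (hf : ∀ σ τ, 0 ≤ f σ τ) :
    ∑ G, √(∑ z : α × α, w (z.1, G) * w (z.2, G) * f z.1 z.2) ≤ √(replicaMean w f) := by
  let R (G : γ) : ℝ := ∑ z : α × α, replicaWeight w (G, z) * f z.1 z.2
  have hR (G : γ) : 0 ≤ R G :=
    Finset.sum_nonneg fun z _ => mul_nonneg (replicaWeight_nonneg hw _) (hf _ _)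
  have hsplit (G : γ) : ∑ z : α × α, w (z.1, G) * w (z.2, G) * f z.1 z.2
      = marginal w G * R G := by
    rw [Finset.mul_sum]
    refine Finset.sum_congr rfl fun z _ => ?_
    rw [← replicaWeight_mul_marginal hw (G, z)]
    ring
  calc ∑ G, √(∑ z : α × α, w (z.1, G) * w (z.2, G) * f z.1 z.2)
      = ∑ G, √(marginal w G) * √(R G) := by
        simp only [hsplit, Real.sqrt_mul (marginal_nonneg hw _)]
    _ ≤ √(∑ G, marginal w G) * √(∑ G, R G) :=
        Real.sum_sqrt_mul_sqrt_le _ (marginal_nonneg hw) hR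
    _ = √(replicaMean w f) := by
        rw [sum_marginal hw1, Real.sqrt_one, one_mul, replicaMean, Fintype.sum_prod_type]

end Replicas

section SecondMoment

theorem dotProduct_sq {ι : Type*} [Fintype ι] (x y : ι → ℝ) :
    (x ⬝ᵥ y) ^ 2 = ∑ e : ι × ι, x e.1 * x e.2 * (y e.1 * y e.2) := by
  rw [sq, dotProduct, Finset.sum_mul_sum, Fintype.sum_prod_type]
  simp only [mul_mul_mul_comm]

/-- The Cauchy–Schwarz inequality for the Frobenius inner product of `∑ a, w a • x a (x a)ᵀ` and
`v vᵀ`. -/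
theorem sum_mul_dotProduct_sq_le {α ι : Type*} [Fintype α] [Fintype ι] (w : α → ℝ)
    (x : α → ι → ℝ) (v : ι → ℝ) :
    ∑ a, w a * (x a ⬝ᵥ v) ^ 2
      ≤ √(∑ z : α × α, w z.1 * w z.2 * (x z.1 ⬝ᵥ x z.2) ^ 2) * (v ⬝ᵥ v) := by
  let A (e : ι × ι) : ℝ := ∑ a, w a * (x a e.1 * x a e.2)
  let V (e : ι × ι) : ℝ := v e.1 * v e.2
  have hAV : ∑ a, w a * (x a ⬝ᵥ v) ^ 2 = ∑ e, A e * V e := by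
    simp only [dotProduct_sq, A, V, Finset.mul_sum, Finset.sum_mul, mul_assoc]
    exact Finset.sum_comm
  have hAA : ∑ z : α × α, w z.1 * w z.2 * (x z.1 ⬝ᵥ x z.2) ^ 2 = ∑ e, A e ^ 2 := by
    have hA (e : ι × ι) : A e ^ 2
        = ∑ z : α × α, w z.1 * w z.2 * (x z.1 e.1 * x z.1 e.2 * (x z.2 e.1 * x z.2 e.2)) := by
      rw [sq, Finset.sum_mul_sum, Fintype.sum_prod_type]
      simp only [mul_mul_mul_comm (w _)]
    simp only [hA, dotProduct_sq, Finset.mul_sum]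
    exact Finset.sum_comm
  have hVV : ∑ e, V e ^ 2 = (v ⬝ᵥ v) ^ 2 := by
    simp only [dotProduct_sq, V, ← sq]
  calc ∑ a, w a * (x a ⬝ᵥ v) ^ 2 = ∑ e, A e * V e := hAV
    _ ≤ √(∑ e, A e ^ 2) * √(∑ e, V e ^ 2) := Real.sum_mul_le_sqrt_mul_sqrt _ A V
    _ = √(∑ z : α × α, w z.1 * w z.2 * (x z.1 ⬝ᵥ x z.2) ^ 2) * (v ⬝ᵥ v) := by
      have hv : 0 ≤ v ⬝ᵥ v := Finset.sum_nonneg fun i _ => mul_self_nonneg (v i)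
      rw [hAA, hVV, Real.sqrt_sq hv]

end SecondMoment

section Likelihood

open Classical in
theorem sum_prod_adj {n : ℕ} (f g : Fin n × Fin n → ℝ) :
    ∑ G : SimpleGraph (Fin n), ∏ e ∈ pairs n, (if G.Adj e.1 e.2 then f e else g e)
      = ∏ e ∈ pairs n, (f e + g e) := by
  have hlt {e : Fin n × Fin n} : e ∈ pairs n ↔ e.1 < e.2 := by simp [pairs]
  rw [Finset.prod_add]
  refine Finset.sum_bij' (fun G _ => (pairs n).filter fun e => G.Adj e.1 e.2)
    (fun t _ => SimpleGraph.fromRel fun u v => (u, v) ∈ t)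
    (fun G _ => by simp) (fun _ _ => Finset.mem_univ _) ?_ ?_ ?_
  · intro G _
    ext u v
    simp only [SimpleGraph.fromRel_adj, Finset.mem_filter, hlt, G.adj_comm v u]
    grind [G.ne_of_adj]
  · intro t ht
    have hsub := Finset.mem_powerset.1 ht
    ext e
    simp only [SimpleGraph.fromRel_adj, Finset.mem_filter]
    grind
  · intro G _
    rw [Finset.prod_ite, Finset.filter_not]

theorem two_mul_sum_pairs_mul_add_dotProduct_self {n : ℕ} (x : Fin n → ℝ) :
    2 * ∑ e ∈ pairs n, x e.1 * x e.2 + x ⬝ᵥ x = (∑ i, x i) ^ 2 := by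
  have hsplit (i j : Fin n) : x i * x j = (if i < j then x i * x j else 0)
      + (if j < i then x j * x i else 0) + if i = j then x i * x j else 0 := by
    rcases lt_trichotomy i j with h | rfl | h
    · simp [h, h.not_gt, h.ne]
    · simp
    · simp [h, h.not_gt, h.ne', mul_comm]
  have hpairs : ∑ e ∈ pairs n, x e.1 * x e.2 = ∑ i, ∑ j, if i < j then x i * x j else 0 := by
    rw [pairs, Finset.sum_filter, Fintype.sum_prod_type]
  calc 2 * ∑ e ∈ pairs n, x e.1 * x e.2 + x ⬝ᵥ x
      = (∑ i, ∑ j, if i < j then x i * x j else 0)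
        + (∑ i, ∑ j, if j < i then x j * x i else 0)
        + ∑ i, ∑ j, (if i = j then x i * x j else 0) := by
        rw [hpairs, Finset.sum_comm (f := fun i j => if j < i then x j * x i else 0)]
        simp [dotProduct, two_mul]
    _ = (∑ i, x i) ^ 2 := by
        simp only [sq, Finset.sum_mul_sum, ← Finset.sum_add_distrib, ← hsplit]

/-- The mean edge density `(p + q) / 2` of the planted partition model. -/
noncomputable def meanProb (p q : unitInterval) : unitInterval :=
  ⟨((p : ℝ) + q) / 2, by constructor <;> linarith [p.2.1, p.2.2, q.2.1, q.2.2]⟩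

/-- The probability of the graph `G` in the Erdős–Rényi model whose edge density is the mean
density of the planted partition model. It is encoded as a planted partition model whose edge
probabilities do not see the labels. -/
noncomputable def nullProb {n : ℕ} (p q : unitInterval) (G : SimpleGraph (Fin n)) : ℝ :=
  graphProb (meanProb p q) (meanProb p q) 1 G

/-- The signal-to-noise ratio of one edge: the variance of the edge probability over its labels,
divided by the variance of a Bernoulli variable of mean `(p + q) / 2`. In the degenerate cases
`p = q = 0` and `p = q = 1` it is `0 / 0 = 0`. The threshold is at `n * snr p q = 1`. -/
noncomputable def snr (p q : unitInterval) : ℝ :=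
  (((p : ℝ) - q) / 2) ^ 2 / (meanProb p q * (1 - meanProb p q))

theorem snr_nonneg (p q : unitInterval) : 0 ≤ snr p q :=
  div_nonneg (sq_nonneg _) (mul_nonneg (meanProb p q).2.1 (sub_nonneg.2 (meanProb p q).2.2))

theorem edgeProb_eq_add_mul_spin {n : ℕ} (p q : unitInterval) (σ : Labeling n) (u v : Fin n) :
    edgeProb p q σ u v = meanProb p q + ((p : ℝ) - q) / 2 * (spin σ u * spin σ v) := by
  simp only [edgeProb, meanProb, spin]
  rcases Int.units_eq_one_or (σ u) with hu | hu <;>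
    rcases Int.units_eq_one_or (σ v) with hv | hv <;>
    simp only [hu, hv, if_true, if_neg (by decide : (1 : ℤˣ) ≠ -1),
      if_neg (by decide : (-1 : ℤˣ) ≠ 1), Units.val_one, Units.val_neg] <;>
    push_cast <;> ring

theorem sub_eq_zero_of_meanProb_mul_eq_zero {p q : unitInterval}
    (h : (meanProb p q : ℝ) * (1 - meanProb p q) = 0) : (p : ℝ) - q = 0 := by
  obtain ⟨⟨hp0, hp1⟩, hq0, hq1⟩ := And.intro p.2 q.2
  simp only [meanProb] at h
  rcases mul_eq_zero.1 h with h | h <;> linarith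

theorem edgeProb_mul_div_add_eq {n : ℕ} (p q : unitInterval) (σ τ : Labeling n) (u v : Fin n) :
    edgeProb p q σ u v * edgeProb p q τ u v / meanProb p q
        + (1 - edgeProb p q σ u v) * (1 - edgeProb p q τ u v) / (1 - meanProb p q)
      = snr p q * (spin (σ * τ) u * spin (σ * τ) v) + 1 := by
  have hspin (i : Fin n) : spin (σ * τ) i = spin σ i * spin τ i := by simp [spin]
  simp only [edgeProb_eq_add_mul_spin, snr, hspin]
  by_cases h : (meanProb p q : ℝ) * (1 - meanProb p q) = 0
  · rw [sub_eq_zero_of_meanProb_mul_eq_zero h]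
    rcases mul_eq_zero.1 h with h | h
    · simp [h]
    · simp [sub_eq_zero.1 h |>.symm]
  · obtain ⟨h0, h1⟩ := mul_ne_zero_iff.1 h
    field_simp
    ring

theorem graphProb_eq_zero_of_nullProb_eq_zero {n : ℕ} {p q : unitInterval}
    {G : SimpleGraph (Fin n)} (hG : nullProb p q G = 0) (σ : Labeling n) :
    graphProb p q σ G = 0 := by
  classical
  obtain ⟨e, he, h⟩ := Finset.prod_eq_zero_iff.1 hG
  refine Finset.prod_eq_zero he ?_
  have hm : edgeProb (meanProb p q) (meanProb p q) 1 e.1 e.2 = meanProb p q := by simp [edgeProb]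
  have hd : (p : ℝ) - q = 0 := by
    apply sub_eq_zero_of_meanProb_mul_eq_zero
    split_ifs at h <;> simp [← hm, h]
  rwa [edgeProb_eq_add_mul_spin, hd, zero_div, zero_mul, add_zero, ← hm]

theorem sum_graphProb_mul_div_nullProb_le {n : ℕ} (p q : unitInterval) (σ τ : Labeling n) :
    ∑ G, graphProb p q σ G * graphProb p q τ G / nullProb p q G
      ≤ Real.exp (snr p q / 2 * (∑ i, spin (σ * τ) i) ^ 2) := by
  classical
  let x := spin (σ * τ)
  have hedge (e : Fin n × Fin n) := edgeProb_mul_div_add_eq p q σ τ e.1 e.2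
  have hfactor (G : SimpleGraph (Fin n)) :
      graphProb p q σ G * graphProb p q τ G / nullProb p q G
        = ∏ e ∈ pairs n, if G.Adj e.1 e.2
          then edgeProb p q σ e.1 e.2 * edgeProb p q τ e.1 e.2 / meanProb p q
          else (1 - edgeProb p q σ e.1 e.2) * (1 - edgeProb p q τ e.1 e.2)
            / (1 - meanProb p q) := by
    simp only [nullProb, graphProb, ← Finset.prod_mul_distrib, ← Finset.prod_div_distrib]
    refine Finset.prod_congr rfl fun e _ => ?_
    split_ifs <;> simp [edgeProb]
  calc ∑ G, graphProb p q σ G * graphProb p q τ G / nullProb p q G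
      = ∏ e ∈ pairs n, (snr p q * (x e.1 * x e.2) + 1) := by
        simp only [hfactor, sum_prod_adj, hedge, x]
    _ ≤ ∏ e ∈ pairs n, Real.exp (snr p q * (x e.1 * x e.2)) := by
        refine Finset.prod_le_prod (fun e _ => ?_) fun e _ => Real.add_one_le_exp _
        obtain ⟨hσ0, hσ1⟩ := edgeProb_mem p q σ e.1 e.2
        obtain ⟨hτ0, hτ1⟩ := edgeProb_mem p q τ e.1 e.2
        rw [← hedge]
        exact add_nonneg (div_nonneg (mul_nonneg hσ0 hτ0) (meanProb p q).2.1)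
          (div_nonneg (mul_nonneg (sub_nonneg.2 hσ1) (sub_nonneg.2 hτ1))
            (sub_nonneg.2 (meanProb p q).2.2))
    _ = Real.exp (snr p q * ∑ e ∈ pairs n, x e.1 * x e.2) := by
        rw [← Real.exp_sum, ← Finset.mul_sum]
    _ ≤ Real.exp (snr p q * ((∑ i, x i) ^ 2 / 2)) := by
        have hself : 0 ≤ x ⬝ᵥ x := Finset.sum_nonneg fun i _ => mul_self_nonneg (x i)
        gcongr
        · exact snr_nonneg p q
        · linarith [two_mul_sum_pairs_mul_add_dotProduct_self x]
    _ = Real.exp (snr p q / 2 * (∑ i, x i) ^ 2) := by ring_nf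

end Likelihood

section Overlap

/-- The normalized inner product of two labelings. Unlike `overlap`, it is not centered. -/
noncomputable def replicaOverlap {n : ℕ} (σ τ : Labeling n) : ℝ := spin σ ⬝ᵥ spin τ / n

theorem sum_mass_mul_div_nullProb_le {n : ℕ} (p q : unitInterval) (c : ℝ) :
    ∑ z : SimpleGraph (Fin n) × Labeling n × Labeling n,
        mass p q (z.2.1, z.1) * mass p q (z.2.2, z.1) / nullProb p q z.1
          * Real.exp (c * (spin z.2.1 ⬝ᵥ spin z.2.2) ^ 2)
      ≤ 𝔼 x : Labeling n, Real.exp ((c + snr p q / 2) * (∑ i, spin x i) ^ 2) := by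
  calc ∑ z : SimpleGraph (Fin n) × Labeling n × Labeling n,
        mass p q (z.2.1, z.1) * mass p q (z.2.2, z.1) / nullProb p q z.1
          * Real.exp (c * (spin z.2.1 ⬝ᵥ spin z.2.2) ^ 2)
      = 𝔼 σ : Labeling n, 𝔼 τ : Labeling n, Real.exp (c * (∑ i, spin (σ * τ) i) ^ 2)
          * ∑ G, graphProb p q σ G * graphProb p q τ G / nullProb p q G := by
        rw [Fintype.sum_prod_type_right, Fintype.sum_prod_type]
        simp only [expect_labeling_eq, spin_dotProduct, mass, Finset.mul_sum]
        refine Finset.sum_congr rfl fun σ _ => Finset.sum_congr rfl fun τ _ =>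
          Finset.sum_congr rfl fun G _ => ?_
        ring
    _ ≤ 𝔼 σ : Labeling n, 𝔼 τ : Labeling n, Real.exp (c * (∑ i, spin (σ * τ) i) ^ 2)
          * Real.exp (snr p q / 2 * (∑ i, spin (σ * τ) i) ^ 2) := by
        refine Finset.expect_le_expect fun σ _ => Finset.expect_le_expect fun τ _ => ?_
        gcongr
        exact sum_graphProb_mul_div_nullProb_le p q σ τ
    _ = 𝔼 x : Labeling n, Real.exp ((c + snr p q / 2) * (∑ i, spin x i) ^ 2) := by
        simp only [← Real.exp_add, ← add_mul]
        exact expect_expect_mul fun x => Real.exp ((c + snr p q / 2) * (∑ i, spin x i) ^ 2)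

theorem replicaMean_replicaOverlap_sq_le {n : ℕ} (hn : 0 < n) {p q : unitInterval} {κ : ℝ}
    (hκ : 0 < κ) (h : n * snr p q ≤ 1 + κ) :
    replicaMean (mass (n := n) p q) (fun σ τ => replicaOverlap σ τ ^ 2)
      ≤ Real.log (2 * n + 1) / n / κ + 27 / 2 * κ := by
  have hn' : (0 : ℝ) < n := by exact_mod_cast hn
  set R := replicaMean (mass (n := n) p q) (fun σ τ => replicaOverlap σ τ ^ 2)
  have hscale (σ τ : Labeling n) :
      κ * n * replicaOverlap σ τ ^ 2 = κ / n * (spin σ ⬝ᵥ spin τ) ^ 2 := by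
    rw [replicaOverlap]
    field_simp
  have hexp : Real.exp (κ * n * R) ≤ (2 * n + 1) * Real.exp (n * (3 / 2 * (3 * κ) ^ 2)) := by
    calc Real.exp (κ * n * R)
        ≤ ∑ z : SimpleGraph (Fin n) × Labeling n × Labeling n,
            mass p q (z.2.1, z.1) * mass p q (z.2.2, z.1) / nullProb p q z.1
              * Real.exp (κ / n * (spin z.2.1 ⬝ᵥ spin z.2.2) ^ 2) := by
          simp only [R, ← replicaMean_const_mul, hscale]
          refine exp_replicaMean_le (mass_nonneg p q) (sum_mass p q)
            (graphProb_nonneg _ _ _) (sum_graphProb _ _ _) (fun G hG => ?_) _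
          simp [marginal, mass, graphProb_eq_zero_of_nullProb_eq_zero hG]
      _ ≤ 𝔼 x : Labeling n, Real.exp ((κ / n + snr p q / 2) * (∑ i, spin x i) ^ 2) :=
          sum_mass_mul_div_nullProb_le p q _
      _ ≤ 𝔼 x : Labeling n, Real.exp ((1 + 3 * κ) / (2 * n) * (∑ i, spin x i) ^ 2) := by
          refine Finset.expect_le_expect fun x _ => ?_
          gcongr
          field_simp
          linarith
      _ ≤ (2 * n + 1) * Real.exp (n * (3 / 2 * (3 * κ) ^ 2)) := expect_exp_sq_sum_spin_le hn _
  have hlog : κ * n * R ≤ Real.log (2 * n + 1) + n * (3 / 2 * (3 * κ) ^ 2) := by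
    rw [← Real.exp_le_exp, Real.exp_add, Real.exp_log (by positivity)]
    exact hexp
  calc R ≤ (Real.log (2 * n + 1) + n * (3 / 2 * (3 * κ) ^ 2)) / (κ * n) :=
        (le_div_iff₀' (by positivity)).2 hlog
    _ = Real.log (2 * n + 1) / n / κ + 27 / 2 * κ := by
        field_simp
        ring

theorem sum_mul_overlap_sq_le {n : ℕ} (w : Labeling n → ℝ) (τ : Labeling n) :
    ∑ σ, w σ * overlap σ τ ^ 2
      ≤ √(∑ z : Labeling n × Labeling n, w z.1 * w z.2 * replicaOverlap z.1 z.2 ^ 2) := by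
  let s := ∑ i, spin τ i
  let v (i : Fin n) : ℝ := spin τ i - s / n
  have hoverlap (σ : Labeling n) : overlap σ τ = spin σ ⬝ᵥ v / n := by
    simp only [overlap, dotProduct, v, s, mul_sub, Finset.sum_sub_distrib, ← Finset.sum_mul, spin]
    ring
  have hv : v ⬝ᵥ v ≤ n := by
    calc v ⬝ᵥ v = n - s ^ 2 / n := by
          have hsq (i : Fin n) : v i * v i = 1 - 2 * (s / n) * spin τ i + (s / n) ^ 2 := by
            rw [← spin_sq τ i]
            ring
          simp only [dotProduct, hsq, Finset.sum_add_distrib, Finset.sum_sub_distrib,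
            ← Finset.mul_sum, Finset.sum_const, Finset.card_univ, Fintype.card_fin, nsmul_eq_mul]
          rcases n.eq_zero_or_pos with rfl | hn
          · simp
          · field_simp
            ring
      _ ≤ n := sub_le_self _ (by positivity)
  set A := ∑ z : Labeling n × Labeling n, w z.1 * w z.2 * (spin z.1 ⬝ᵥ spin z.2) ^ 2 with hA
  calc ∑ σ, w σ * overlap σ τ ^ 2 = (∑ σ, w σ * (spin σ ⬝ᵥ v) ^ 2) / n ^ 2 := by
        simp only [hoverlap, div_pow, Finset.sum_div, mul_div_assoc]
    _ ≤ √A * (v ⬝ᵥ v) / n ^ 2 := by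
        gcongr
        exact sum_mul_dotProduct_sq_le w spin v
    _ ≤ √A * n / n ^ 2 := by gcongr
    _ = √(A / n ^ 2) := by
        rw [Real.sqrt_div' _ (sq_nonneg _), Real.sqrt_sq (Nat.cast_nonneg _)]
        rcases n.eq_zero_or_pos with rfl | hn
        · simp
        · field_simp
    _ = √(∑ z : Labeling n × Labeling n, w z.1 * w z.2 * replicaOverlap z.1 z.2 ^ 2) := by
        simp only [hA, replicaOverlap, div_pow, Finset.sum_div, mul_div_assoc]

end Overlap

section Estimates

/-- The second moment of `overlapLaw`, as an explicit finite sum. -/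
noncomputable def meanSqOverlap {n : ℕ} (p q : unitInterval) (est : Estimate n) : ℝ :=
  ∑ x : Labeling n × SimpleGraph (Fin n), ∑ τ,
    mass p q x * ((est x.2 τ).toReal * overlap x.1 τ ^ 2)

theorem sum_toReal_apply {α : Type*} [Fintype α] (μ : PMF α) : ∑ x, (μ x).toReal = 1 := by
  rw [← ENNReal.toReal_sum fun x _ => μ.apply_ne_top x, ← tsum_fintype (L := .unconditional α),
    μ.tsum_coe, ENNReal.toReal_one]

theorem meanSqOverlap_nonneg {n : ℕ} (p q : unitInterval) (est : Estimate n) :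
    0 ≤ meanSqOverlap p q est :=
  Finset.sum_nonneg fun x _ => Finset.sum_nonneg fun _ _ =>
    mul_nonneg (mass_nonneg p q x) (mul_nonneg ENNReal.toReal_nonneg (sq_nonneg _))

theorem meanSqOverlap_le {n : ℕ} (p q : unitInterval) (est : Estimate n) :
    meanSqOverlap p q est
      ≤ √(replicaMean (mass (n := n) p q) fun σ τ => replicaOverlap σ τ ^ 2) := by
  let B (G : SimpleGraph (Fin n)) : ℝ := √(∑ z : Labeling n × Labeling n,
    mass p q (z.1, G) * mass p q (z.2, G) * replicaOverlap z.1 z.2 ^ 2)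
  calc meanSqOverlap p q est
      = ∑ G, ∑ τ, (est G τ).toReal * ∑ σ, mass p q (σ, G) * overlap σ τ ^ 2 := by
        simp only [meanSqOverlap, Fintype.sum_prod_type_right, Finset.mul_sum, mul_left_comm]
        exact Finset.sum_congr rfl fun G _ => Finset.sum_comm
    _ ≤ ∑ G, ∑ τ, (est G τ).toReal * B G := by
        gcongr
        exact sum_mul_overlap_sq_le _ _
    _ = ∑ G, B G := by simp only [← Finset.sum_mul, sum_toReal_apply, one_mul]
    _ ≤ √(replicaMean (mass (n := n) p q) fun σ τ => replicaOverlap σ τ ^ 2) :=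
        sum_sqrt_sum_le_sqrt_replicaMean (mass_nonneg p q) (sum_mass p q) fun _ _ => sq_nonneg _

theorem toOuterMeasure_abs_ge_le {α : Type*} [Fintype α] (μ : PMF α) (X : α → ℝ) {ε : ℝ}
    (hε : 0 < ε) :
    μ.toOuterMeasure {a | ε ≤ |X a|} ≤ ENNReal.ofReal (∑ a, (μ a).toReal * X a ^ 2 / ε ^ 2) := by
  rw [PMF.toOuterMeasure_apply_fintype, ENNReal.ofReal_sum_of_nonneg fun a _ => by positivity]
  refine Finset.sum_le_sum fun a _ =>
    Set.indicator_apply_le' (fun ha => ?_) fun _ => zero_le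
  have hone : 1 ≤ X a ^ 2 / ε ^ 2 := by
    rw [one_le_div (by positivity), ← sq_abs (X a)]
    gcongr
    exact ha
  rw [ENNReal.le_ofReal_iff_toReal_le (μ.apply_ne_top a) (by positivity), mul_div_assoc]
  exact le_mul_of_one_le_right ENNReal.toReal_nonneg hone

theorem overlapLaw_toMeasure_le {n : ℕ} (p q : unitInterval) (est : Estimate n) {ε : ℝ}
    (hε : 0 < ε) :
    (overlapLaw p q est).toMeasure {x : ℝ | ε ≤ |x|}
      ≤ ENNReal.ofReal (meanSqOverlap p q est / ε ^ 2) := by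
  have hmeas : MeasurableSet {x : ℝ | ε ≤ |x|} :=
    measurableSet_le measurable_const continuous_abs.measurable
  rw [PMF.toMeasure_apply_eq_toOuterMeasure_apply _ hmeas, overlapLaw,
    PMF.toOuterMeasure_bind_apply, tsum_fintype]
  calc ∑ x, model n p q x * ((est x.2).map fun τ => overlap x.1 τ).toOuterMeasure {x | ε ≤ |x|}
      ≤ ∑ x, ENNReal.ofReal (mass p q x)
          * ENNReal.ofReal (∑ τ, (est x.2 τ).toReal * overlap x.1 τ ^ 2 / ε ^ 2) := by
        gcongr with x
        · exact le_rfl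
        · rw [PMF.toOuterMeasure_map_apply]
          exact toOuterMeasure_abs_ge_le (est x.2) (overlap x.1) hε
    _ = ENNReal.ofReal (meanSqOverlap p q est / ε ^ 2) := by
        simp only [← ENNReal.ofReal_mul (mass_nonneg p q _)]
        rw [← ENNReal.ofReal_sum_of_nonneg fun x _ => mul_nonneg (mass_nonneg p q x)
          (Finset.sum_nonneg fun τ _ => by positivity)]
        simp only [meanSqOverlap, Finset.mul_sum, Finset.sum_div, mul_div_assoc]

theorem tendstoZeroInProbability_overlapLaw {p q : ℕ → unitInterval} {est : ∀ n, Estimate n}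
    (h : Tendsto (fun n => meanSqOverlap (p n) (q n) (est n)) atTop (𝓝 0)) :
    TendstoZeroInProbability fun n => overlapLaw (p n) (q n) (est n) := by
  intro ε hε
  refine tendsto_of_tendsto_of_tendsto_of_le_of_le tendsto_const_nhds ?_ (fun _ => zero_le)
    fun n => overlapLaw_toMeasure_le (p n) (q n) (est n) hε
  simpa using ENNReal.tendsto_ofReal (h.div_const (ε ^ 2))

end Estimates

section Asymptotics

theorem tendsto_log_two_mul_add_one_div :
    Tendsto (fun n : ℕ => Real.log (2 * n + 1) / n) atTop (𝓝 0) := by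
  have hlim : Tendsto (fun n : ℕ => (2 * n + 1 : ℝ)) atTop atTop :=
    tendsto_atTop_add_const_right _ _
      (tendsto_natCast_atTop_atTop.const_mul_atTop two_pos)
  have h := (Real.tendsto_pow_log_div_mul_add_atTop (1 / 2) (-1 / 2) 1 (by norm_num)).comp hlim
  refine h.congr fun n => ?_
  simp only [Function.comp_apply, pow_one]
  ring_nf

theorem tendsto_replicaMean_replicaOverlap_sq {p q : ℕ → unitInterval}
    (h : ∀ κ > 0, ∀ᶠ n : ℕ in atTop, n * snr (p n) (q n) ≤ 1 + κ) :
    Tendsto (fun n => replicaMean (mass (n := n) (p n) (q n)) fun σ τ => replicaOverlap σ τ ^ 2)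
      atTop (𝓝 0) := by
  have hnonneg (n : ℕ) :
      0 ≤ replicaMean (mass (n := n) (p n) (q n)) fun σ τ => replicaOverlap σ τ ^ 2 :=
    Finset.sum_nonneg fun z _ =>
      mul_nonneg (replicaWeight_nonneg (mass_nonneg _ _) z) (sq_nonneg _)
  refine tendsto_order.2 ⟨fun δ hδ => .of_forall fun n => hδ.trans_le (hnonneg n), fun δ hδ => ?_⟩
  let κ := δ / 27
  have hκ : 0 < κ := by positivity
  have hlim : Tendsto (fun n : ℕ => Real.log (2 * n + 1) / n / κ + 27 / 2 * κ) atTop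
      (𝓝 (0 / κ + 27 / 2 * κ)) :=
    (tendsto_log_two_mul_add_one_div.div_const κ).add_const _
  have hlt : 0 / κ + 27 / 2 * κ < δ := by
    simp only [κ, zero_div]
    linarith
  filter_upwards [h κ hκ, hlim.eventually (gt_mem_nhds hlt), eventually_gt_atTop 0]
    with n hsnr hδn hn
  exact (replicaMean_replicaOverlap_sq_le hn hκ hsnr).trans_lt hδn

theorem tendsto_meanSqOverlap {p q : ℕ → unitInterval}
    (h : ∀ κ > 0, ∀ᶠ n : ℕ in atTop, n * snr (p n) (q n) ≤ 1 + κ) (est : ∀ n, Estimate n) :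
    Tendsto (fun n => meanSqOverlap (p n) (q n) (est n)) atTop (𝓝 0) := by
  refine tendsto_of_tendsto_of_tendsto_of_le_of_le tendsto_const_nhds ?_
    (fun n => meanSqOverlap_nonneg _ _ (est n)) fun n => meanSqOverlap_le _ _ (est n)
  simpa using (tendsto_replicaMean_replicaOverlap_sq h).sqrt

theorem tendsto_sub_of_eventually_sq_le {p q : ℕ → unitInterval} {C : ℝ}
    (h : ∀ᶠ n : ℕ in atTop, n * ((p n : ℝ) - q n) ^ 2 ≤ C) :
    Tendsto (fun n => (p n : ℝ) - q n) atTop (𝓝 0) := by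
  have hsq : Tendsto (fun n => ((p n : ℝ) - q n) ^ 2) atTop (𝓝 0) := by
    refine tendsto_of_tendsto_of_tendsto_of_le_of_le' tendsto_const_nhds
      (tendsto_natCast_atTop_atTop.const_div_atTop C)
      (.of_forall fun n => sq_nonneg _) ?_
    filter_upwards [h, eventually_gt_atTop 0] with n hC hn
    exact (le_div_iff₀' (by exact_mod_cast hn)).2 hC
  rw [tendsto_zero_iff_abs_tendsto_zero]
  simpa [Real.sqrt_sq_eq_abs, Function.comp_def] using hsq.sqrt

theorem eventually_natCast_mul_snr_le {p q : ℕ → unitInterval} {p₀ : ℝ} (hp₀ : p₀ < 1)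
    (hp : Tendsto (fun n => (p n : ℝ)) atTop (𝓝 p₀))
    (h : ∀ᶠ n : ℕ in atTop, n * ((p n : ℝ) - q n) ^ 2 ≤ 2 * (1 - p₀) * ((p n : ℝ) + q n)) :
    ∀ κ > 0, ∀ᶠ n : ℕ in atTop, n * snr (p n) (q n) ≤ 1 + κ := by
  intro κ hκ
  have hd : Tendsto (fun n => (p n : ℝ) - q n) atTop (𝓝 0) := by
    refine tendsto_sub_of_eventually_sq_le (C := 2 * (1 - p₀) * 2) (h.mono fun n hn => hn.trans ?_)
    gcongr
    linarith [(p n).2.2, (q n).2.2]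
  have hm : Tendsto (fun n => (meanProb (p n) (q n) : ℝ)) atTop (𝓝 p₀) := by
    have hsub := hp.sub (hd.div_const 2)
    rw [zero_div, sub_zero] at hsub
    refine hsub.congr fun n => ?_
    simp only [meanProb]
    ring
  have hvar : ∀ᶠ n in atTop, 1 - p₀ < (1 + κ) * (1 - meanProb (p n) (q n)) := by
    refine ((hm.const_sub 1).const_mul (1 + κ)).eventually (lt_mem_nhds ?_)
    exact lt_mul_of_one_lt_left (sub_pos.2 hp₀) (by linarith)
  filter_upwards [h, hvar] with n hn hvarn
  have hm0 := (meanProb (p n) (q n)).2.1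
  have hm1 := (meanProb (p n) (q n)).2.2
  rw [snr, ← mul_div_assoc]
  refine div_le_of_le_mul₀ (mul_nonneg hm0 (sub_nonneg.2 hm1)) (by positivity) ?_
  calc n * (((p n : ℝ) - q n) / 2) ^ 2 = n * ((p n : ℝ) - q n) ^ 2 / 4 := by ring
    _ ≤ 2 * (1 - p₀) * ((p n : ℝ) + q n) / 4 := by gcongr
    _ = meanProb (p n) (q n) * (1 - p₀) := by
        simp only [meanProb]
        ring
    _ ≤ meanProb (p n) (q n) * ((1 + κ) * (1 - meanProb (p n) (q n))) := by gcongr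
    _ = (1 + κ) * (meanProb (p n) (q n) * (1 - meanProb (p n) (q n))) := by ring

theorem eventually_natCast_mul_snr_le_of_degrees {p q : ℕ → unitInterval} {a b : ℕ → ℝ}
    (ha : ∀ n, a n = n * (p n : ℝ)) (hb : ∀ n, b n = n * (q n : ℝ)) {p₀ : ℝ} (hp₀ : p₀ < 1)
    (hlim : Tendsto (fun n => a n / n) atTop (𝓝 p₀))
    (h : ∀ᶠ n in atTop, (a n - b n) ^ 2 ≤ 2 * (1 - p₀) * (a n + b n)) :
    ∀ κ > 0, ∀ᶠ n : ℕ in atTop, n * snr (p n) (q n) ≤ 1 + κ := by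
  refine eventually_natCast_mul_snr_le hp₀ (hlim.congr' ?_) ?_
  · filter_upwards [eventually_ne_atTop 0] with n hn
    rw [ha, mul_div_cancel_left₀ _ (Nat.cast_ne_zero.2 hn)]
  · filter_upwards [h, eventually_gt_atTop 0] with n hab hn
    have hn' : (0 : ℝ) < n := by exact_mod_cast hn
    rw [ha, hb] at hab
    refine le_of_mul_le_mul_left ?_ hn'
    linarith

theorem sq_sub_le_of_div_lt_one {a b t : ℝ} (ha : 0 ≤ a) (hb : 0 ≤ b) (ht : 0 < t)
    (h : (a - b) ^ 2 / (a + b) / t < 1) : (a - b) ^ 2 ≤ t * (a + b) := by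
  rcases (add_nonneg ha hb).eq_or_lt with hab | hab
  · obtain ⟨rfl, rfl⟩ := (add_eq_zero_iff_of_nonneg ha hb).1 hab.symm
    simp
  · rw [div_lt_one ht, div_lt_iff₀ hab] at h
    exact h.le

end Asymptotics

end SBM

theorem theorem3_general (p q : ℕ → unitInterval)
    (h : ∀ κ > 0, ∀ᶠ n : ℕ in atTop, n * SBM.snr (p n) (q n) ≤ 1 + κ)
    (est : ∀ n, SBM.Estimate n) :
    SBM.TendstoZeroInProbability fun n => SBM.overlapLaw (p n) (q n) (est n) :=
  SBM.tendstoZeroInProbability_overlapLaw (SBM.tendsto_meanSqOverlap h est)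

theorem theorem3 (p q : ℕ → unitInterval) (a b : ℕ → ℝ)
    (ha : ∀ n, a n = n * (p n : ℝ)) (hb : ∀ n, b n = n * (q n : ℝ)) :
    (Tendsto a atTop atTop → Tendsto b atTop atTop →
      a =o[atTop] (fun n => (n : ℝ)) →
      (∀ᶠ n in atTop, (a n - b n) ^ 2 < 2 * (a n + b n)) →
      ∀ est : ∀ n, SBM.Estimate n,
        SBM.TendstoZeroInProbability fun n => SBM.overlapLaw (p n) (q n) (est n)) ∧
    (∀ p₀ : ℝ, 0 < p₀ → p₀ < 1 →
      Tendsto (fun n => a n / n) atTop (𝓝 p₀) →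
      (∀ᶠ n in atTop, (a n - b n) ^ 2 / (a n + b n) / (2 * (1 - p₀)) < 1) →
      ∀ est : ∀ n, SBM.Estimate n,
        SBM.TendstoZeroInProbability fun n => SBM.overlapLaw (p n) (q n) (est n)) :=
  ⟨fun _ _ ho h => theorem3_general p q <|
    SBM.eventually_natCast_mul_snr_le_of_degrees ha hb one_pos ho.tendsto_div_nhds_zero <|
      h.mono fun n hn => by simpa using hn.le,
  fun _ _ hp₀ hlim h => theorem3_general p q <|
    SBM.eventually_natCast_mul_snr_le_of_degrees ha hb hp₀ hlim <| h.mono fun n hn =>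
      SBM.sq_sub_le_of_div_lt_one (by rw [ha]; exact mul_nonneg n.cast_nonneg (p n).2.1)
        (by rw [hb]; exact mul_nonneg n.cast_nonneg (q n).2.1) (by linarith) hn⟩
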